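/- Let $(X,\rho)$ be a Hadamard space, that is, a complete $\mathrm{CAT}(0)$ space (a complete uniquely geodesic metric space whose geodesic triangles are no thicker than their comparison triangles in $\mathbb R^2$). For $p,q\in X$ let $\gamma_{p,q}$ denote the geodesic from $p$ to $q$, and for $t\in[0,1]$ put $(1-t)p\oplus tq=\gamma_{p,q}(t\rho(p,q))$. Let $\angle_p(x,y)$ be the Alexandrov angle at $p$ between $\gamma_{p,x}$ and $\gamma_{p,y}$ for $x,y\neq p$ (with $\angle_p(x,y)=\pi/2$ if exactly one of $x,y$ equals $p$, and $\angle_p(p,p)=0$). The tangent space $T_pX$ is the metric space obtained from the set of all pairs $(a,\gamma_{p,x})$, $a\ge 0$, $x\in X$, with the pseudometric $$\tilde d_p\bigl((a,\gamma_{p,x}),(b,\gamma_{p,y})\bigr)=\sqrt{(a\rho(p,x))^2+(b\rho(p,y))^2-2\,a\rho(p,x)\,b\rho(p,y)\cos\angle_p(x,y)}$$ by identifying pairs at distance $0$; $d_p$ is its metric, $a\gamma_{p,x}$ denotes the class of $(a,\gamma_{p,x})$, $\gamma_{p,x}=1\gamma_{p,x}$, and $0_p=0\gamma_{p,p}$.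 For $u,v\in T_pX$ put $g_p(u,v)=\frac12\bigl(d_p(u,0_p)^2+d_p(v,0_p)^2-d_p(u,v)^2\bigr)$. Let $A$ be a monotone vector field on $X$, that is, $A$ assigns to each $x\in X$ a (possibly empty) subset $Ax\subset T_xX$ so that $$g_x(x^*,\gamma_{x,y})+g_y(y^*,\gamma_{y,x})\le 0\qquad\text{whenever } x,y\in X,\ x^*\in Ax,\ y^*\in Ay.$$ Suppose that $A$ satisfies the surjectivity condition: for all $\lambda>0$ and $x\in X$ there is $z\in X$ with $\frac1\lambda\gamma_{z,x}\in Az$. Let $J_\lambda$ be the resolvent of $A$, where $J_\lambda x$ is the (unique) point $z$ with $\frac1\lambda\gamma_{z,x}\in Az$, and let $\operatorname{Zer}(A)=\{u\in X: 0_u\in Au\}$. Let $\{\alpha_n\}_{n\ge1}$ be a sequence in $[0,1)$ and $\{\lambda_n\}_{n\ge1}$ a sequence of positive real numbers such that $\sum_{n=1}^\infty(1-\alpha_n)\lambda_n=\infty$. Let $x_1\in X$ and $$x_{n+1}=\alpha_nx_n\oplus(1-\alpha_n)J_{\lambda_n}x_n\qquad(n=1,2,\dots).$$ Then the following hold. (i)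 $\{J_{\lambda_n}x_n\}$ is bounded if and only if $\operatorname{Zer}(A)$ is nonempty. (ii) If $\operatorname{Zer}(A)$ is nonempty, $\sup_n\alpha_n<1$ and $\inf_n\lambda_n>0$, then there is a point $x_\infty\in\operatorname{Zer}(A)$ to which both $\{x_n\}$ and $\{J_{\lambda_n}x_n\}$ are $\Delta$-convergent. Here a sequence $\{y_n\}$ in $X$ is $\Delta$-convergent to $p\in X$ if for every subsequence $\{y_{n_i}\}$ the set of all $z\in X$ with $\limsup_i\rho(z,y_{n_i})\le\limsup_i\rho(y,y_{n_i})$ for every $y\in X$ equals $\{p\}$. -/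

import Mathlib

open Filter Topology
open scoped NNReal

noncomputable section

namespace HadamardProx

/-- `γ`, restricted to `[0, dist p q]`, is a geodesic from `p` to `q`. (A geodesic
`[0, l] → X` from `p` to `q` necessarily has `l = dist p q`; the values of `γ` outside
`[0, dist p q]` are irrelevant.) -/
def IsGeodesic {X : Type*} [MetricSpace X] (p q : X) (γ : ℝ → X) : Prop :=
  γ 0 = p ∧ γ (dist p q) = q ∧
    ∀ s ∈ Set.Icc 0 (dist p q), ∀ t ∈ Set.Icc 0 (dist p q), dist (γ s) (γ t) = |s - t|

/-- Any two points are joined by a geodesic, unique as a map on `[0, dist p q]`. -/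
class UniquelyGeodesicSpace (X : Type*) [MetricSpace X] : Prop where
  exists_geodesic : ∀ p q : X, ∃ γ : ℝ → X, IsGeodesic p q γ
  unique_geodesic : ∀ (p q : X) (γ η : ℝ → X), IsGeodesic p q γ → IsGeodesic p q η →
    Set.EqOn γ η (Set.Icc 0 (dist p q))

/-- The geodesic `γ_{p,q}` from `p` to `q`, parametrized by `[0, dist p q]`. -/
def geod {X : Type*} [MetricSpace X] [UniquelyGeodesicSpace X] (p q : X) : ℝ → X :=
  (UniquelyGeodesicSpace.exists_geodesic p q).choose

/-- The convex combination `(1 - t) p ⊕ t q`, for `t ∈ [0, 1]`. -/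
def comb {X : Type*} [MetricSpace X] [UniquelyGeodesicSpace X] (t : ℝ) (p q : X) : X :=
  geod p q (t * dist p q)

/-- `CAT(0)` spaces. A Hadamard space is a complete `CAT(0)` space. -/
class CAT0Space (X : Type*) [MetricSpace X] : Prop extends UniquelyGeodesicSpace X where
  comparison : ∀ (x y z : X) (x' y' z' : EuclideanSpace ℝ (Fin 2)),
    dist x y = dist x' y' → dist y z = dist y' z' → dist z x = dist z' x' →
    ∀ a ∈ Set.Icc (0 : ℝ) 1, ∀ b ∈ Set.Icc (0 : ℝ) 1,
      dist (comb a x y) (comb b x z) ≤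
        dist ((1 - a) • x' + a • y') ((1 - b) • x' + b • z')

/-- The cosine, by the law of cosines, of the angle at `p'` of a Euclidean triangle
`p', x', y'` having the same side lengths as `p, x, y` (where `x ≠ p` and `y ≠ p`). -/
def compCos {X : Type*} [MetricSpace X] (p x y : X) : ℝ :=
  (dist p x ^ 2 + dist p y ^ 2 - dist x y ^ 2) / (2 * dist p x * dist p y)

open Classical in
/-- The comparison angle at `p` between `γ_{p,x}` and `γ_{p,y}`. -/
def compAngle {X : Type*} [MetricSpace X] (p x y : X) : ℝ :=
  if x = p ∧ y = p then 0
  else if x = p ∨ y = p then Real.pi / 2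
  else Real.arccos (compCos p x y)

open Classical in
/-- The Alexandrov angle at `p` between `γ_{p,x}` and `γ_{p,y}`: the limit of the comparison
angles of `γ_{p,x}(s)`, `γ_{p,y}(t)` as `s, t → 0+`. The limit exists in a `CAT(0)` space, see
`tendsto_compAngle`. -/
def angle {X : Type*} [MetricSpace X] [UniquelyGeodesicSpace X] (p x y : X) : ℝ :=
  if x = p ∧ y = p then 0
  else if x = p ∨ y = p then Real.pi / 2
  else limUnder (𝓝[>] (0 : ℝ) ×ˢ 𝓝[>] (0 : ℝ))
    (fun st : ℝ × ℝ => compAngle p (geod p x st.1) (geod p y st.2))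

/-- The set `[0, ∞) × Γ_p`, where `Γ_p` is the set of geodesics from `p`; such a geodesic is
`γ_{p,x}` for exactly one `x`, its end point, by which it is recorded here. -/
structure PreTangent {X : Type*} (p : X) where
  coeff : ℝ≥0
  endpt : X

/-- The pseudometric on `[0, ∞) × Γ_p` (the Euclidean cone distance for the angle at `p`). -/
def preDist {X : Type*} [MetricSpace X] [UniquelyGeodesicSpace X] {p : X}
    (v w : PreTangent p) : ℝ :=
  √((v.coeff * dist p v.endpt) ^ 2 + (w.coeff * dist p w.endpt) ^ 2
    - 2 * (v.coeff * dist p v.endpt) * (w.coeff * dist p w.endpt)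
      * Real.cos (angle p v.endpt w.endpt))

section Geodesics

variable {X : Type*} [MetricSpace X]

lemma geod_spec [UniquelyGeodesicSpace X] (p q : X) : IsGeodesic p q (geod p q) :=
  (UniquelyGeodesicSpace.exists_geodesic p q).choose_spec

lemma dist_geod_left [UniquelyGeodesicSpace X] (p q : X) {s : ℝ}
    (hs : s ∈ Set.Icc 0 (dist p q)) : dist p (geod p q s) = s := by
  obtain ⟨h0, -, h⟩ := geod_spec p q
  have := h 0 ⟨le_rfl, dist_nonneg⟩ s hs
  rw [h0] at this
  rw [this, zero_sub, abs_neg, abs_of_nonneg hs.1]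

lemma geod_geod [UniquelyGeodesicSpace X] (p q : X) {s t : ℝ} (hs : 0 ≤ s) (hst : s ≤ t)
    (ht : t ≤ dist p q) : geod p (geod p q t) s = geod p q s := by
  have hd : dist p (geod p q t) = t := dist_geod_left p q ⟨hs.trans hst, ht⟩
  obtain ⟨h0, -, h⟩ := geod_spec p q
  refine UniquelyGeodesicSpace.unique_geodesic p (geod p q t) _ _ (geod_spec _ _) ?_ ?_
  · refine ⟨h0, by rw [hd], ?_⟩
    rw [hd]
    exact fun a ha b hb => h a ⟨ha.1, ha.2.trans ht⟩ b ⟨hb.1, hb.2.trans ht⟩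
  · rw [hd]; exact ⟨hs, hst⟩

lemma exists_comparison {a b c : ℝ} (ha : 0 < a) (hb : 0 < b) (h1 : c ≤ a + b)
    (h2 : |a - b| ≤ c) : ∃ u v : EuclideanSpace ℝ (Fin 2), ‖u‖ = a ∧ ‖v‖ = b ∧ ‖u - v‖ = c := by
  have hc : 0 ≤ c := (abs_nonneg _).trans h2
  obtain ⟨k, hk⟩ : ∃ k, k = (a ^ 2 + b ^ 2 - c ^ 2) / (2 * a * b) := ⟨_, rfl⟩
  have hk' : 2 * a * b * k = a ^ 2 + b ^ 2 - c ^ 2 := by rw [hk]; field_simp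
  have hab : 0 < 2 * a * b := by positivity
  have h3 : (a - b) ^ 2 ≤ c ^ 2 := by
    rw [← sq_abs (a - b)]; exact pow_le_pow_left₀ (abs_nonneg _) h2 2
  have h4 : c ^ 2 ≤ (a + b) ^ 2 := pow_le_pow_left₀ hc h1 2
  have hk1 : k ≤ 1 := by
    rw [hk, div_le_one hab]; nlinarith
  have hk2 : -1 ≤ k := by
    rw [hk, le_div_iff₀ hab]; nlinarith
  have hsq : √(1 - k ^ 2) ^ 2 = 1 - k ^ 2 := Real.sq_sqrt (by nlinarith)
  refine ⟨!₂[a, 0], !₂[b * k, b * √(1 - k ^ 2)], ?_, ?_, ?_⟩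
  · rw [EuclideanSpace.norm_eq, Real.sqrt_eq_iff_eq_sq (by positivity) ha.le]
    simp
  · rw [EuclideanSpace.norm_eq, Real.sqrt_eq_iff_eq_sq (by positivity) hb.le]
    simp [mul_pow, hsq]
    ring
  · rw [EuclideanSpace.norm_eq, Real.sqrt_eq_iff_eq_sq (by positivity) hc]
    simp [mul_pow, hsq]
    linear_combination -hk'

lemma compCos_le_one {p x y : X} (hx : x ≠ p) (hy : y ≠ p) : compCos p x y ≤ 1 := by
  have h1 : 0 < dist p x := dist_pos.2 hx.symm
  have h2 : 0 < dist p y := dist_pos.2 hy.symm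
  have h := abs_dist_sub_le x y p
  rw [dist_comm x p, dist_comm y p] at h
  have h3 : (dist p x - dist p y) ^ 2 ≤ dist x y ^ 2 := by
    rw [← sq_abs (dist p x - dist p y)]; exact pow_le_pow_left₀ (abs_nonneg _) h 2
  rw [compCos, div_le_one (by positivity)]
  nlinarith

lemma neg_one_le_compCos {p x y : X} (hx : x ≠ p) (hy : y ≠ p) : -1 ≤ compCos p x y := by
  have h1 : 0 < dist p x := dist_pos.2 hx.symm
  have h2 : 0 < dist p y := dist_pos.2 hy.symm
  have h := dist_triangle_left x y p
  have h3 : dist x y ^ 2 ≤ (dist p x + dist p y) ^ 2 := pow_le_pow_left₀ dist_nonneg h 2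
  rw [compCos, le_div_iff₀ (by positivity)]
  nlinarith

variable [CAT0Space X]

lemma geod_ne {p x : X} {s : ℝ} (hs : 0 < s) (hs' : s ≤ dist p x) : geod p x s ≠ p := by
  intro h
  have := dist_geod_left p x ⟨hs.le, hs'⟩
  rw [h, dist_self] at this
  exact hs.ne this

/-- Comparison cosines decrease along two geodesics issuing from `p`. -/
lemma compCos_mono {p x y : X} {s t S T : ℝ} (hs : 0 < s) (hsS : s ≤ S) (hS : S ≤ dist p x)
    (ht : 0 < t) (htT : t ≤ T) (hT : T ≤ dist p y) :
    compCos p (geod p x S) (geod p y T) ≤ compCos p (geod p x s) (geod p y t) := by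
  have hS0 : 0 < S := hs.trans_le hsS
  have hT0 : 0 < T := ht.trans_le htT
  have dS : dist p (geod p x S) = S := dist_geod_left p x ⟨hS0.le, hS⟩
  have dT : dist p (geod p y T) = T := dist_geod_left p y ⟨hT0.le, hT⟩
  have ds : dist p (geod p x s) = s := dist_geod_left p x ⟨hs.le, hsS.trans hS⟩
  have dt : dist p (geod p y t) = t := dist_geod_left p y ⟨ht.le, htT.trans hT⟩
  obtain ⟨D, hD⟩ : ∃ D, D = dist (geod p x S) (geod p y T) := ⟨_, rfl⟩
  obtain ⟨d, hd⟩ : ∃ d, d = dist (geod p x s) (geod p y t) := ⟨_, rfl⟩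
  have t1 := dist_triangle_left (geod p x S) (geod p y T) p
  have t2 := abs_dist_sub_le (geod p x S) (geod p y T) p
  rw [dist_comm _ p, dist_comm _ p] at t2
  rw [dS, dT, ← hD] at t1 t2
  obtain ⟨u, v, hu, hv, huv⟩ := exists_comparison hS0 hT0 t1 t2
  have key := CAT0Space.comparison p (geod p x S) (geod p y T) 0 u v
    (by rw [dS, dist_zero_left, hu]) (by rw [← hD, dist_eq_norm, huv])
    (by rw [dist_comm, dT, dist_zero_right, hv])
    (s / S) ⟨by positivity, (div_le_one hS0).2 hsS⟩ (t / T) ⟨by positivity, (div_le_one hT0).2 htT⟩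
  rw [comb, comb, dS, dT, div_mul_cancel₀ _ hS0.ne', div_mul_cancel₀ _ hT0.ne',
    geod_geod p x hs.le hsS hS, geod_geod p y ht.le htT hT, ← hd, smul_zero, smul_zero, zero_add,
    zero_add, dist_eq_norm] at key
  have key2 := pow_le_pow_left₀ (hd ▸ dist_nonneg) key 2
  have huv2 := norm_sub_sq_real u v
  rw [norm_sub_sq_real, norm_smul, norm_smul, inner_smul_left, inner_smul_right, hu, hv,
    Real.norm_of_nonneg (by positivity), Real.norm_of_nonneg (by positivity),
    div_mul_cancel₀ _ hS0.ne', div_mul_cancel₀ _ hT0.ne'] at key2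
  simp only [conj_trivial] at key2
  rw [hu, hv, huv] at huv2
  have hin : inner ℝ u v = (S ^ 2 + T ^ 2 - D ^ 2) / 2 := by linarith
  rw [compCos, compCos, dS, dT, ds, dt, ← hD, ← hd, le_div_iff₀ (by positivity)]
  have e : (S ^ 2 + T ^ 2 - D ^ 2) / (2 * S * T) * (2 * s * t)
      = 2 * (s / S * (t / T * inner ℝ u v)) := by
    rw [hin]; field_simp
  rw [e]
  linarith

lemma exists_tendsto_compCos {p x y : X} (hx : x ≠ p) (hy : y ≠ p) :
    ∃ c ∈ Set.Icc (-1 : ℝ) 1, Tendsto (fun st : ℝ × ℝ => compCos p (geod p x st.1) (geod p y st.2))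
      (𝓝[>] (0 : ℝ) ×ˢ 𝓝[>] (0 : ℝ)) (𝓝 c) := by
  have hx0 : 0 < dist p x := dist_pos.2 hx.symm
  have hy0 : 0 < dist p y := dist_pos.2 hy.symm
  set A : Set ℝ := (fun st : ℝ × ℝ => compCos p (geod p x st.1) (geod p y st.2)) ''
    (Set.Ioc 0 (dist p x) ×ˢ Set.Ioc 0 (dist p y)) with hA
  have hle : ∀ a ∈ A, a ≤ 1 := by
    rintro _ ⟨⟨s, t⟩, ⟨hs, ht⟩, rfl⟩
    exact compCos_le_one (geod_ne hs.1 hs.2) (geod_ne ht.1 ht.2)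
  have hge : ∀ a ∈ A, -1 ≤ a := by
    rintro _ ⟨⟨s, t⟩, ⟨hs, ht⟩, rfl⟩
    exact neg_one_le_compCos (geod_ne hs.1 hs.2) (geod_ne ht.1 ht.2)
  have hbdd : BddAbove A := ⟨1, hle⟩
  have hne : A.Nonempty :=
    ⟨_, ⟨(dist p x, dist p y), ⟨⟨hx0, le_rfl⟩, ⟨hy0, le_rfl⟩⟩, rfl⟩⟩
  have ev : ∀ {S T : ℝ}, 0 < S → 0 < T → ∀ᶠ st : ℝ × ℝ in 𝓝[>] (0 : ℝ) ×ˢ 𝓝[>] (0 : ℝ),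
      st.1 ∈ Set.Ioc 0 S ∧ st.2 ∈ Set.Ioc 0 T := fun hS hT =>
    prod_mem_prod (Ioc_mem_nhdsGT hS) (Ioc_mem_nhdsGT hT)
  refine ⟨sSup A, ⟨?_, csSup_le hne hle⟩, tendsto_order.2 ⟨?_, ?_⟩⟩
  · obtain ⟨a, ha⟩ := hne
    exact (hge a ha).trans (le_csSup hbdd ha)
  · intro c hc
    obtain ⟨_, ⟨⟨S, T⟩, ⟨hS, hT⟩, rfl⟩, h⟩ := exists_lt_of_lt_csSup hne hc
    filter_upwards [ev hS.1 hT.1] with st hst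
    exact h.trans_le (compCos_mono hst.1.1 hst.1.2 hS.2 hst.2.1 hst.2.2 hT.2)
  · intro c hc
    filter_upwards [ev hx0 hy0] with st hst
    exact (le_csSup hbdd ⟨st, ⟨hst.1, hst.2⟩, rfl⟩).trans_lt hc

/-- The limit that defines the Alexandrov angle exists. -/
lemma tendsto_compAngle {p x y : X} (hx : x ≠ p) (hy : y ≠ p) :
    Tendsto (fun st : ℝ × ℝ => compAngle p (geod p x st.1) (geod p y st.2))
      (𝓝[>] (0 : ℝ) ×ˢ 𝓝[>] (0 : ℝ)) (𝓝 (angle p x y)) := by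
  obtain ⟨c, -, h⟩ := exists_tendsto_compCos hx hy
  rw [angle, if_neg (by tauto), if_neg (by tauto)]
  refine tendsto_nhds_limUnder ⟨Real.arccos c, ?_⟩
  refine ((Real.continuous_arccos.tendsto c).comp h).congr' ?_
  filter_upwards [prod_mem_prod (Ioc_mem_nhdsGT (dist_pos.2 hx.symm))
    (Ioc_mem_nhdsGT (dist_pos.2 hy.symm))] with st hst
  have h1 := geod_ne hst.1.1 hst.1.2
  have h2 := geod_ne hst.2.1 hst.2.2
  rw [compAngle, if_neg (by tauto), if_neg (by tauto)]
  rfl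

lemma tendsto_compCos {p x y : X} (hx : x ≠ p) (hy : y ≠ p) :
    Tendsto (fun st : ℝ × ℝ => compCos p (geod p x st.1) (geod p y st.2))
      (𝓝[>] (0 : ℝ) ×ˢ 𝓝[>] (0 : ℝ)) (𝓝 (Real.cos (angle p x y))) := by
  refine ((Real.continuous_cos.tendsto _).comp (tendsto_compAngle hx hy)).congr' ?_
  filter_upwards [prod_mem_prod (Ioc_mem_nhdsGT (dist_pos.2 hx.symm))
    (Ioc_mem_nhdsGT (dist_pos.2 hy.symm))] with st hst
  have h1 := geod_ne hst.1.1 hst.1.2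
  have h2 := geod_ne hst.2.1 hst.2.2
  rw [Function.comp_apply, compAngle, if_neg (by tauto), if_neg (by tauto),
    Real.cos_arccos (neg_one_le_compCos h1 h2) (compCos_le_one h1 h2)]

/-- The cone distance is the limit of rescaled distances along the geodesics. -/
lemma tendsto_preDist {p : X} (v w : PreTangent p) :
    Tendsto (fun t : ℝ => dist (geod p v.endpt (v.coeff * dist p v.endpt * t))
      (geod p w.endpt (w.coeff * dist p w.endpt * t)) / t) (𝓝[>] 0) (𝓝 (preDist v w)) := by
  obtain ⟨α', x⟩ := v
  obtain ⟨β', y⟩ := w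
  simp only [preDist]
  obtain ⟨α, hα', hα⟩ : ∃ α : ℝ, α = α' ∧ 0 ≤ α := ⟨_, rfl, α'.2⟩
  obtain ⟨β, hβ', hβ⟩ : ∃ β : ℝ, β = β' ∧ 0 ≤ β := ⟨_, rfl, β'.2⟩
  rw [← hα', ← hβ']
  obtain ⟨a, ha⟩ : ∃ a, a = α * dist p x := ⟨_, rfl⟩
  obtain ⟨b, hb⟩ : ∃ b, b = β * dist p y := ⟨_, rfl⟩
  rw [← ha, ← hb]
  have ha0 : 0 ≤ a := by rw [ha]; positivity
  have hb0 : 0 ≤ b := by rw [hb]; positivity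
  have small : ∀ (q : X) (δ c : ℝ), 0 ≤ δ → c = δ * dist p q → ∀ᶠ t : ℝ in 𝓝[>] 0,
      c * t ∈ Set.Icc 0 (dist p q) := by
    intro q δ c hδ hc
    have h1 : (0 : ℝ) < 1 / (δ + 1) := by positivity
    filter_upwards [Ioc_mem_nhdsGT h1] with t ht
    have h2 : δ * t ≤ 1 := by
      have := (le_div_iff₀ (by positivity)).1 ht.2
      nlinarith [ht.1]
    have h3 : c * t = (δ * t) * dist p q := by rw [hc]; ring
    rw [h3]
    exact ⟨mul_nonneg (mul_nonneg hδ ht.1.le) dist_nonneg,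
      mul_le_of_le_one_left dist_nonneg h2⟩
  have hpos : ∀ᶠ t : ℝ in 𝓝[>] 0, 0 < t := self_mem_nhdsWithin
  rcases ha0.eq_or_lt with ha' | ha'
  · subst ha'
    refine Tendsto.congr' ?_ tendsto_const_nhds
    filter_upwards [small y β b hβ hb, hpos] with t ht ht0
    rw [zero_mul, (geod_spec p x).1, dist_geod_left p y ht]
    simp [Real.sqrt_sq hb0, ht0.ne']
  rcases hb0.eq_or_lt with hb' | hb'
  · subst hb'
    refine Tendsto.congr' ?_ tendsto_const_nhds
    filter_upwards [small x α a hα ha, hpos] with t ht ht0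
    rw [zero_mul, (geod_spec p y).1, dist_comm, dist_geod_left p x ht]
    simp [Real.sqrt_sq ha0, ht0.ne']
  have hx : x ≠ p := by
    rintro rfl; simp at ha; exact ha'.ne' ha
  have hy : y ≠ p := by
    rintro rfl; simp at hb; exact hb'.ne' hb
  have sc : ∀ c : ℝ, 0 < c → Tendsto (fun t : ℝ => c * t) (𝓝[>] 0) (𝓝[>] 0) := by
    intro c hc
    refine tendsto_nhdsWithin_iff.2 ⟨?_, ?_⟩
    · have : Tendsto (fun t : ℝ => c * t) (𝓝 0) (𝓝 (c * 0)) :=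
        (continuous_const.mul continuous_id).tendsto 0
      rw [mul_zero] at this
      exact this.mono_left nhdsWithin_le_nhds
    · filter_upwards [hpos] with t ht
      exact mul_pos hc ht
  have lim := (tendsto_compCos hx hy).comp ((sc a ha').prodMk (sc b hb'))
  have lim2 := ((lim.const_mul (2 * a * b)).const_sub (a ^ 2 + b ^ 2)).sqrt
  refine lim2.congr' ?_
  filter_upwards [small x α a hα ha, small y β b hβ hb, hpos] with t h1 h2 ht
  have e1 := dist_geod_left p x h1
  have e2 := dist_geod_left p y h2
  have e : a ^ 2 + b ^ 2 - 2 * a * b *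
      compCos p (geod p x (a * t)) (geod p y (b * t)) =
      (dist (geod p x (a * t)) (geod p y (b * t)) / t) ^ 2 := by
    rw [compCos, e1, e2]
    field_simp
    ring
  simp only [Function.comp_apply]
  rw [e, Real.sqrt_sq (by positivity)]

end Geodesics

section Tangent

variable {X : Type*} [MetricSpace X] [CAT0Space X]

/-- The pseudometric of `[0, ∞) × Γ_p`. -/
instance (p : X) : PseudoMetricSpace (PreTangent p) where
  dist := preDist
  dist_self v := by
    refine tendsto_nhds_unique (tendsto_preDist v v) ?_
    simp
  dist_comm v w := by
    refine tendsto_nhds_unique (tendsto_preDist v w) ?_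
    simpa only [dist_comm] using tendsto_preDist w v
  dist_triangle u v w := by
    refine le_of_tendsto_of_tendsto (tendsto_preDist u w)
      ((tendsto_preDist u v).add (tendsto_preDist v w)) ?_
    filter_upwards [self_mem_nhdsWithin] with t ht
    have ht' : (0 : ℝ) < t := ht
    rw [← add_div]
    gcongr
    exact dist_triangle _ _ _

/-- The tangent space `T_p X`: the quotient of `[0, ∞) × Γ_p` by the relation of having
distance `0`, with the induced metric. -/
abbrev TangentSp (p : X) : Type _ := SeparationQuotient (PreTangent p)

/-- The tangent vector `a γ_{p,x}`, the class of `(a, γ_{p,x})`. -/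
def tvec (p : X) (a : ℝ≥0) (x : X) : TangentSp p := SeparationQuotient.mk ⟨a, x⟩

/-- The vertex `0_p` of the tangent space. -/
def vertex (p : X) : TangentSp p := tvec p 0 p

/-- The product `g_p` on the tangent space. -/
def gprod {p : X} (u v : TangentSp p) : ℝ :=
  (dist u (vertex p) ^ 2 + dist v (vertex p) ^ 2 - dist u v ^ 2) / 2

end Tangent

section VectorFields

variable {X : Type*} [MetricSpace X] [CAT0Space X]

/-- Monotonicity of a (set-valued) vector field `A`, `A x ⊆ T_x X`. -/
def IsMonotoneField (A : (x : X) → Set (TangentSp x)) : Prop :=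
  ∀ x y : X, ∀ u ∈ A x, ∀ v ∈ A y, gprod u (tvec x 1 y) + gprod v (tvec y 1 x) ≤ 0

/-- The set `J_r x` of all `z` with `(1 / r) γ_{z,x} ∈ A z`, where `r > 0`. -/
def resolvent (A : (x : X) → Set (TangentSp x)) (r : ℝ) (x : X) : Set X :=
  {z | tvec z (Real.toNNReal (1 / r)) x ∈ A z}

/-- The surjectivity condition. -/
def SurjectivityCondition (A : (x : X) → Set (TangentSp x)) : Prop :=
  ∀ r : ℝ, 0 < r → ∀ x : X, ∃ z : X, z ∈ resolvent A r x

/-- The set of zero points of `A`. -/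
def zer (A : (x : X) → Set (TangentSp x)) : Set X := {u | vertex u ∈ A u}

end VectorFields

section DeltaConvergence

variable {X : Type*} [MetricSpace X]

/-- The asymptotic center of a sequence (upper limits are taken in `[0, ∞]`). -/
def asymptoticCenter (x : ℕ → X) : Set X :=
  {z | ∀ y : X, limsup (fun n => edist z (x n)) atTop ≤ limsup (fun n => edist y (x n)) atTop}

/-- `Δ`-convergence of a sequence to `p`. -/
def DeltaConverges (x : ℕ → X) (p : X) : Prop :=
  ∀ φ : ℕ → ℕ, StrictMono φ → asymptoticCenter (x ∘ φ) = {p}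

end DeltaConvergence

end HadamardProx

end

/-!
In a `CAT(0)` space the Alexandrov angle is at most the comparison angle, so `g_z` is bounded below
by the law of cosines (`le_gprod_tvec`). Monotonicity of the field at two values `z ∈ J_r x` and
`w ∈ J_s y` of the resolvent therefore yields an inequality between squared distances
(`IsMonotoneField.resolvent_ineq`), and from then on tangent spaces play no role. A point is a zero
of the field exactly when it is a value of the resolvent at itself (`self_mem_resolvent_iff`).

The second ingredient is that, in a complete `CAT(0)` space, the upper limit of a bounded sequence
of averages of squared distances is uniformly convex, hence has exactly one minimizer
(`SqDistLike.exists_isMin`, `SqDistLike.eq_of_isMin`).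

For (i), if there is a zero then the distances to it do not increase along the iteration, and
everything is bounded. Conversely, if the `z_n = J_{λ_n} x_n` are bounded, let `y` minimize the
upper limit of the averages of `dist y (z_n) ^ 2` with weights `(1 - α_n) λ_n`, and let `w = J_1 y`.
The resolvent inequality at `z_n` and `w` telescopes, and as the weights have divergent sum it shows
that the value of the functional at `w` is at most its value at `y` minus `dist w y ^ 2`. Hence
`w = y` is a zero.

For (ii), the Fejér inequality `fejer_ineq` forces `dist (z_n) (x_n) → 0`. The resolvent inequality
then shows that the asymptotic center of every subsequence is a zero, by the same comparison of `y`
with `J_1 y` (`asymptoticCenter_subset_zer`). As the distances from `x_n` to each zero converge,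
all these asymptotic centers coincide (`exists_deltaConverges`).
-/

namespace HadamardProx

/-! ### Tangent vectors and the resolvent inequality -/

section Tangent

variable {X : Type*} [MetricSpace X] [CAT0Space X]

lemma compCos_le_cos_angle {p x y : X} (hx : x ≠ p) (hy : y ≠ p) :
    compCos p x y ≤ Real.cos (angle p x y) := by
  refine ge_of_tendsto (tendsto_compCos hx hy) ?_
  filter_upwards [prod_mem_prod (Ioc_mem_nhdsGT (dist_pos.2 hx.symm))
    (Ioc_mem_nhdsGT (dist_pos.2 hy.symm))] with st hst
  have h := compCos_mono (p := p) (x := x) (y := y) hst.1.1 hst.1.2 le_rfl hst.2.1 hst.2.2 le_rfl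
  rwa [(geod_spec p x).2.1, (geod_spec p y).2.1] at h

lemma dist_tvec_sq (p : X) (a b : ℝ≥0) (x y : X) :
    dist (tvec p a x) (tvec p b y) ^ 2 = (a * dist p x) ^ 2 + (b * dist p y) ^ 2
      - 2 * (a * dist p x) * (b * dist p y) * Real.cos (angle p x y) := by
  have h : dist (tvec p a x) (tvec p b y) = preDist (p := p) ⟨a, x⟩ ⟨b, y⟩ := rfl
  rw [h, preDist, Real.sq_sqrt]
  have hs : 0 ≤ (a * dist p x) * (b * dist p y) := by positivity
  nlinarith [sq_nonneg (a * dist p x - b * dist p y), Real.cos_le_one (angle p x y)]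

lemma gprod_tvec (p : X) (a b : ℝ≥0) (x y : X) :
    gprod (tvec p a x) (tvec p b y) =
      a * dist p x * (b * dist p y) * Real.cos (angle p x y) := by
  rw [gprod, vertex, dist_tvec_sq, dist_tvec_sq, dist_tvec_sq]
  simp only [NNReal.coe_zero]
  ring

lemma tvec_self (p : X) (a : ℝ≥0) : tvec p a p = vertex p := by
  rw [← dist_eq_zero, ← sq_eq_zero_iff, vertex, dist_tvec_sq]
  simp

/-- The Alexandrov angle is at most the comparison angle, so `g_p` dominates the Euclidean
inner product given by the law of cosines. -/
lemma le_gprod_tvec (p : X) (a : ℝ≥0) (x y : X) :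
    a * ((dist p x ^ 2 + dist p y ^ 2 - dist x y ^ 2) / 2) ≤
      gprod (tvec p a x) (tvec p 1 y) := by
  rw [gprod_tvec, NNReal.coe_one, one_mul, mul_assoc, mul_assoc]
  refine mul_le_mul_of_nonneg_left ?_ a.2
  by_cases hx : x = p
  · subst hx; simp
  by_cases hy : y = p
  · subst hy; simp [dist_comm]
  have h := compCos_le_cos_angle hx hy
  have h1 : 0 < dist p x := dist_pos.2 (Ne.symm hx)
  have h2 : 0 < dist p y := dist_pos.2 (Ne.symm hy)
  rw [compCos, div_le_iff₀ (by positivity)] at h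
  linarith

variable {A : (x : X) → Set (TangentSp x)}

lemma self_mem_resolvent_iff {r : ℝ} {u : X} : u ∈ resolvent A r u ↔ u ∈ zer A := by
  simp [resolvent, zer, tvec_self]

/-- Monotonicity of the field at two values of the resolvent, in terms of distances only. -/
lemma IsMonotoneField.resolvent_ineq (hA : IsMonotoneField A) {r s : ℝ} (hr : 0 < r) (hs : 0 < s)
    {x y z w : X} (hz : z ∈ resolvent A r x) (hw : w ∈ resolvent A s y) :
    s * (dist z x ^ 2 + dist z w ^ 2 - dist x w ^ 2) +
      r * (dist w y ^ 2 + dist z w ^ 2 - dist y z ^ 2) ≤ 0 := by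
  have h := hA z w _ hz _ hw
  have h1 := le_gprod_tvec z (Real.toNNReal (1 / r)) x w
  have h2 := le_gprod_tvec w (Real.toNNReal (1 / s)) y z
  rw [Real.coe_toNNReal _ (by positivity)] at h1 h2
  rw [dist_comm w z] at h2
  have h3 := mul_le_mul_of_nonneg_left ((add_le_add h1 h2).trans h)
    (by positivity : 0 ≤ 2 * r * s)
  have e : 2 * r * s * (1 / r * ((dist z x ^ 2 + dist z w ^ 2 - dist x w ^ 2) / 2) +
      1 / s * ((dist w y ^ 2 + dist z w ^ 2 - dist y z ^ 2) / 2)) =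
      s * (dist z x ^ 2 + dist z w ^ 2 - dist x w ^ 2) +
      r * (dist w y ^ 2 + dist z w ^ 2 - dist y z ^ 2) := by
    field_simp
  linarith

/-- The resolvent is firmly quasi-nonexpansive with respect to every zero of the field. -/
lemma IsMonotoneField.resolvent_zer_ineq (hA : IsMonotoneField A) {r : ℝ} (hr : 0 < r)
    {x z u : X} (hz : z ∈ resolvent A r x) (hu : u ∈ zer A) :
    dist z x ^ 2 + dist z u ^ 2 ≤ dist x u ^ 2 := by
  have h := hA z u _ hz _ hu
  have h1 := le_gprod_tvec z (Real.toNNReal (1 / r)) x u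
  have h2 : gprod (vertex u) (tvec u 1 z) = 0 := by
    rw [vertex, gprod_tvec]; simp
  rw [Real.coe_toNNReal _ (by positivity)] at h1
  rw [h2] at h
  have h3 : 0 < 1 / r := by positivity
  by_contra! h4
  have := mul_pos h3 (by linarith : 0 < (dist z x ^ 2 + dist z u ^ 2 - dist x u ^ 2) / 2)
  linarith

end Tangent

/-! ### Convexity of the squared distance -/

section Convexity

variable {X : Type*} [MetricSpace X] [CAT0Space X]

/-- The quadratic form of the `CAT(0)` inequality. -/
lemma dist_comb_sq_le {t : ℝ} (ht : t ∈ Set.Icc (0 : ℝ) 1) (p q z : X) :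
    dist (comb t p q) z ^ 2 ≤
      (1 - t) * dist p z ^ 2 + t * dist q z ^ 2 - t * (1 - t) * dist p q ^ 2 := by
  have hmem : t * dist p q ∈ Set.Icc 0 (dist p q) :=
    ⟨mul_nonneg ht.1 dist_nonneg, mul_le_of_le_one_left dist_nonneg ht.2⟩
  have hd : dist p (comb t p q) = t * dist p q := dist_geod_left p q hmem
  -- A nondegenerate comparison triangle is only available when `z ≠ p` and `q ≠ p`.
  by_cases hz : z = p
  · subst hz
    rw [dist_comm, hd, dist_self, dist_comm q z]
    apply le_of_eq; ring
  by_cases hq : q = p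
  · subst hq
    rw [dist_self, mul_zero, dist_eq_zero] at hd
    rw [← hd, dist_self]
    apply le_of_eq; ring
  have h1 : 0 < dist p q := dist_pos.2 (Ne.symm hq)
  have h2 : 0 < dist p z := dist_pos.2 (Ne.symm hz)
  have t2 := abs_dist_sub_le q z p
  rw [dist_comm _ p, dist_comm _ p] at t2
  obtain ⟨u, v, hu, hv, huv⟩ := exists_comparison h1 h2 (dist_triangle_left q z p) t2
  have key := CAT0Space.comparison p q z 0 u v (by rw [dist_zero_left, hu])
    (by rw [dist_eq_norm, huv]) (by rw [dist_comm, dist_zero_right, hv]) t ht 1 ⟨zero_le_one, le_rfl⟩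
  have e : comb 1 p z = z := by rw [comb, one_mul, (geod_spec p z).2.1]
  rw [e, smul_zero, smul_zero, zero_add, zero_add, one_smul, dist_eq_norm] at key
  have key2 := pow_le_pow_left₀ dist_nonneg key 2
  have huv2 := norm_sub_sq_real u v
  rw [norm_sub_sq_real, norm_smul, inner_smul_left, hu, hv, Real.norm_of_nonneg ht.1] at key2
  simp only [conj_trivial] at key2
  rw [hu, hv, huv] at huv2
  have : t * inner ℝ u v = t * ((dist p q ^ 2 + dist p z ^ 2 - dist q z ^ 2) / 2) := by
    congr 1; linarith
  nlinarith

end Convexity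

lemma dist_sq_le_mul_add {X : Type*} [MetricSpace X] {ε : ℝ} (hε : 0 < ε) (a b z : X) :
    dist a z ^ 2 ≤ (1 + ε) * dist b z ^ 2 + (1 + 1 / ε) * dist a b ^ 2 := by
  have h := pow_le_pow_left₀ dist_nonneg (dist_triangle a b z) 2
  have h2 : 0 ≤ (ε * dist b z - dist a b) ^ 2 / ε := by positivity
  have e : (ε * dist b z - dist a b) ^ 2 / ε =
      ε * dist b z ^ 2 - 2 * dist b z * dist a b + 1 / ε * dist a b ^ 2 := by
    field_simp
    ring
  linarith

/-! ### Upper limits of uniformly convex functions -/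

section Limsup

lemma limsup_le_of_eventually_le_add {f g h e : ℕ → ℝ} {a b c : ℝ} (ha : 0 ≤ a) (hb : 0 ≤ b)
    (hf : IsBoundedUnder (· ≤ ·) atTop f) (hg : IsBoundedUnder (· ≤ ·) atTop g)
    (hh : IsBoundedUnder (· ≥ ·) atTop h) (he : Tendsto e atTop (𝓝 0))
    (hle : ∀ᶠ n in atTop, h n ≤ a * f n + b * g n + c + e n) :
    limsup h atTop ≤ a * limsup f atTop + b * limsup g atTop + c := by
  refine le_of_forall_pos_le_add fun ε hε => ?_
  obtain ⟨δ, hδ, hδε⟩ : ∃ δ > 0, a * δ + b * δ + δ ≤ ε :=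
    ⟨ε / (a + b + 1), by positivity, le_of_eq (by field_simp)⟩
  refine limsup_le_of_le hh.isCoboundedUnder_le ?_
  filter_upwards [hle, he.eventually_lt_const hδ,
    eventually_lt_of_limsup_lt (lt_add_of_pos_right _ hδ) hf,
    eventually_lt_of_limsup_lt (lt_add_of_pos_right _ hδ) hg] with n h1 h2 h3 h4
  have := mul_le_mul_of_nonneg_left h3.le ha
  have := mul_le_mul_of_nonneg_left h4.le hb
  linarith

variable {X : Type*} [MetricSpace X] [CAT0Space X]

/-- A sequence of functions that behave like averages of squared distances: bounded and
nonnegative at each point, uniformly convex along midpoints, and with square roots that are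
uniformly Lipschitz (the last condition being put in a form that averages inherit termwise). -/
structure SqDistLike (f : ℕ → X → ℝ) : Prop where
  nonneg : ∀ n y, 0 ≤ f n y
  bounded : ∀ y, ∃ C, ∀ n, f n y ≤ C
  mid : ∀ a b, ∀ᶠ n in atTop,
    f n (comb (1 / 2) a b) ≤ 1 / 2 * f n a + 1 / 2 * f n b - dist a b ^ 2 / 4
  lip : ∀ ε > 0, ∀ a b, ∀ᶠ n in atTop,
    f n a ≤ (1 + ε) * f n b + (1 + 1 / ε) * dist a b ^ 2

namespace SqDistLike

variable {f : ℕ → X → ℝ}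

lemma isBoundedUnder_le (hf : SqDistLike f) (y : X) : IsBoundedUnder (· ≤ ·) atTop (fun n => f n y) :=
  let ⟨C, hC⟩ := hf.bounded y
  isBoundedUnder_of ⟨C, hC⟩

lemma isBoundedUnder_ge (hf : SqDistLike f) (y : X) : IsBoundedUnder (· ≥ ·) atTop (fun n => f n y) :=
  isBoundedUnder_of ⟨0, fun n => hf.nonneg n y⟩

/-- An asymptotic inequality between values at two points passes to the upper limits. -/
lemma limsup_le (hf : SqDistLike f) {e : ℕ → ℝ} {a c : ℝ} (ha : 0 ≤ a)
    (he : Tendsto e atTop (𝓝 0)) (w y : X)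
    (hle : ∀ᶠ n in atTop, f n w ≤ a * f n y + c + e n) :
    limsup (fun n => f n w) atTop ≤ a * limsup (fun n => f n y) atTop + c := by
  have := limsup_le_of_eventually_le_add (b := 0) (c := c) ha le_rfl (hf.isBoundedUnder_le y)
    (hf.isBoundedUnder_le y) (hf.isBoundedUnder_ge w) he
    (by filter_upwards [hle] with n hn; linarith)
  linarith

lemma limsup_nonneg (hf : SqDistLike f) (y : X) : 0 ≤ limsup (fun n => f n y) atTop :=
  le_limsup_of_frequently_le (Frequently.of_forall fun n => hf.nonneg n y) (hf.isBoundedUnder_le y)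

lemma limsup_mid (hf : SqDistLike f) (a b : X) : limsup (fun n => f n (comb (1 / 2) a b)) atTop ≤
    1 / 2 * limsup (fun n => f n a) atTop + 1 / 2 * limsup (fun n => f n b) atTop
      - dist a b ^ 2 / 4 := by
  have := limsup_le_of_eventually_le_add (a := 1 / 2) (b := 1 / 2)
    (h := fun n => f n (comb (1 / 2) a b)) (c := - (dist a b ^ 2 / 4)) (by norm_num) (by norm_num)
    (hf.isBoundedUnder_le a) (hf.isBoundedUnder_le b) (hf.isBoundedUnder_ge _)
    (tendsto_const_nhds (x := (0 : ℝ)))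
    (by filter_upwards [hf.mid a b] with n hn; linarith)
  linarith

lemma eq_of_isMin (hf : SqDistLike f) {y z : X}
    (hy : ∀ w, limsup (fun n => f n y) atTop ≤ limsup (fun n => f n w) atTop)
    (hz : ∀ w, limsup (fun n => f n z) atTop ≤ limsup (fun n => f n w) atTop) : z = y := by
  have h1 := hf.limsup_mid z y
  have h2 := hy (comb (1 / 2) z y)
  have h3 := hz y
  have : dist z y ^ 2 ≤ 0 := by linarith
  exact dist_eq_zero.1 (pow_eq_zero_iff two_ne_zero |>.1 (this.antisymm (sq_nonneg _)))

/-- Minimizing sequences of the upper limit are Cauchy by uniform convexity. -/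
lemma exists_isMin [CompleteSpace X] [Nonempty X] (hf : SqDistLike f) :
    ∃ y, ∀ w, limsup (fun n => f n y) atTop ≤ limsup (fun n => f n w) atTop := by
  set F : X → ℝ := fun y => limsup (fun n => f n y) atTop with hF
  have hbdd : BddBelow (Set.range F) := ⟨0, by rintro _ ⟨y, rfl⟩; exact hf.limsup_nonneg y⟩
  set I := ⨅ y, F y with hI
  have hIle : ∀ y, I ≤ F y := fun y => ciInf_le hbdd y
  have hI0 : 0 ≤ I := le_ciInf hf.limsup_nonneg
  have hex : ∀ n : ℕ, ∃ y, F y < I + (1 / 2 : ℝ) ^ n := fun n =>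
    exists_lt_of_ciInf_lt (lt_add_of_pos_right _ (by positivity))
  choose y hy using hex
  have hpow : Tendsto (fun n : ℕ => (1 / 2 : ℝ) ^ n) atTop (𝓝 0) :=
    tendsto_pow_atTop_nhds_zero_of_lt_one (by norm_num) (by norm_num)
  have hcau : CauchySeq y := by
    refine cauchySeq_of_le_tendsto_0' (fun n => √(4 * (1 / 2 : ℝ) ^ n)) (fun n m hnm => ?_) ?_
    · apply Real.le_sqrt_of_sq_le
      have h1 : F (comb (1 / 2) (y n) (y m)) ≤
        1 / 2 * F (y n) + 1 / 2 * F (y m) - dist (y n) (y m) ^ 2 / 4 := hf.limsup_mid _ _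
      have h2 := hIle (comb (1 / 2) (y n) (y m))
      have h3 : (1 / 2 : ℝ) ^ m ≤ (1 / 2) ^ n :=
        pow_le_pow_of_le_one (by norm_num) (by norm_num) hnm
      linarith [hy n, hy m]
    · have := (hpow.const_mul 4).sqrt
      simpa using this
  obtain ⟨p, hp⟩ := cauchySeq_tendsto_of_complete hcau
  refine ⟨p, fun w => le_trans ?_ (hIle w)⟩
  -- The upper limit is lower semicontinuous: let `n → ∞` in `lip`, then `ε → 0`.
  have hε : ∀ ε : ℝ, 0 < ε → F p ≤ (1 + ε) * I := by
    intro ε hε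
    have hle : ∀ n, F p ≤ (1 + ε) * (I + (1 / 2 : ℝ) ^ n) + (1 + 1 / ε) * dist p (y n) ^ 2 := by
      intro n
      have h := hf.limsup_le (a := 1 + ε) (c := (1 + 1 / ε) * dist p (y n) ^ 2) (by positivity)
        (tendsto_const_nhds (x := (0 : ℝ))) p (y n)
        (by filter_upwards [hf.lip ε hε p (y n)] with n hn; linarith)
      refine h.trans ?_
      gcongr
      exact (hy n).le
    have hlim : Tendsto (fun n => (1 + ε) * (I + (1 / 2 : ℝ) ^ n)
        + (1 + 1 / ε) * dist p (y n) ^ 2) atTop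
        (𝓝 ((1 + ε) * (I + 0) + (1 + 1 / ε) * dist p p ^ 2)) :=
      ((hpow.const_add I).const_mul _).add (((tendsto_const_nhds.dist hp).pow 2).const_mul _)
    simpa using ge_of_tendsto' hlim hle
  have hlim : Tendsto (fun ε : ℝ => (1 + ε) * I) (𝓝[>] 0) (𝓝 ((1 + 0) * I)) :=
    ((continuous_const.add continuous_id).mul continuous_const).tendsto 0
      |>.mono_left nhdsWithin_le_nhds
  rw [add_zero, one_mul] at hlim
  exact ge_of_tendsto hlim (by filter_upwards [self_mem_nhdsWithin] with ε h using hε ε h)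

end SqDistLike

end Limsup

lemma comb_half_sq_le {X : Type*} [MetricSpace X] [CAT0Space X] (a b z : X) :
    dist (comb (1 / 2) a b) z ^ 2 ≤
      1 / 2 * dist a z ^ 2 + 1 / 2 * dist b z ^ 2 - dist a b ^ 2 / 4 := by
  have := dist_comb_sq_le (t := 1 / 2) ⟨by norm_num, by norm_num⟩ a b z
  linarith

lemma exists_forall_dist_le {X : Type*} [MetricSpace X] {s : ℕ → X}
    (hs : Bornology.IsBounded (Set.range s)) (y : X) : ∃ K, ∀ n, dist y (s n) ≤ K := by
  obtain ⟨K, hK⟩ := hs.subset_closedBall y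
  exact ⟨K, fun n => by simpa [dist_comm] using hK ⟨n, rfl⟩⟩

lemma sqDistLike_dist_sq {X : Type*} [MetricSpace X] [CAT0Space X] {s : ℕ → X}
    (hs : Bornology.IsBounded (Set.range s)) : SqDistLike (fun n y => dist y (s n) ^ 2) where
  nonneg _ _ := sq_nonneg _
  bounded y :=
    let ⟨K, hK⟩ := exists_forall_dist_le hs y
    ⟨K ^ 2, fun n => pow_le_pow_left₀ dist_nonneg (hK n) 2⟩
  mid a b := Eventually.of_forall fun n => comb_half_sq_le a b (s n)
  lip _ hε a b := Eventually.of_forall fun n => dist_sq_le_mul_add hε a b (s n)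

/-- The average of the squared distances to `s 0, …, s (N - 1)` with weights `w`. -/
noncomputable def avgSqDist {X : Type*} [MetricSpace X] (w : ℕ → ℝ) (s : ℕ → X) (N : ℕ) (y : X) :
    ℝ :=
  (∑ k ∈ Finset.range N, w k * dist y (s k) ^ 2) / ∑ k ∈ Finset.range N, w k

lemma sqDistLike_avgSqDist {X : Type*} [MetricSpace X] [CAT0Space X] {w : ℕ → ℝ} {s : ℕ → X}
    (hw : ∀ n, 0 ≤ w n) (hsum : Tendsto (fun N => ∑ k ∈ Finset.range N, w k) atTop atTop)
    (hs : Bornology.IsBounded (Set.range s)) : SqDistLike (avgSqDist w s) where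
  nonneg N y := div_nonneg (Finset.sum_nonneg fun k _ => mul_nonneg (hw k) (sq_nonneg _))
    (Finset.sum_nonneg fun k _ => hw k)
  bounded y := by
    obtain ⟨K, hK⟩ := exists_forall_dist_le hs y
    refine ⟨K ^ 2, fun N => div_le_of_le_mul₀ (Finset.sum_nonneg fun k _ => hw k) (sq_nonneg _) ?_⟩
    rw [Finset.mul_sum]
    refine Finset.sum_le_sum fun k _ => ?_
    rw [mul_comm]
    exact mul_le_mul_of_nonneg_right (pow_le_pow_left₀ dist_nonneg (hK k) 2) (hw k)
  mid a b := by
    filter_upwards [hsum.eventually_gt_atTop 0] with N hN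
    rw [avgSqDist, avgSqDist, avgSqDist, div_le_iff₀ hN, sub_mul, add_mul, mul_assoc, mul_assoc,
      div_mul_cancel₀ _ hN.ne', div_mul_cancel₀ _ hN.ne', Finset.mul_sum, Finset.mul_sum,
      Finset.mul_sum, ← Finset.sum_add_distrib, ← Finset.sum_sub_distrib]
    refine Finset.sum_le_sum fun k _ => ?_
    have := mul_le_mul_of_nonneg_left (comb_half_sq_le a b (s k)) (hw k)
    linarith
  lip ε hε a b := by
    filter_upwards [hsum.eventually_gt_atTop 0] with N hN
    rw [avgSqDist, avgSqDist, div_le_iff₀ hN, add_mul, mul_assoc, div_mul_cancel₀ _ hN.ne',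
      Finset.mul_sum, Finset.mul_sum, ← Finset.sum_add_distrib]
    refine Finset.sum_le_sum fun k _ => ?_
    have := mul_le_mul_of_nonneg_left (dist_sq_le_mul_add hε a b (s k)) (hw k)
    linarith

/-! ### Asymptotic centers -/

section AsymptoticCenter

variable {X : Type*} [MetricSpace X]

lemma limsup_edist_eq {s : ℕ → X} (hs : Bornology.IsBounded (Set.range s)) (y : X) :
    limsup (fun n => edist y (s n)) atTop =
      ENNReal.ofReal (√(limsup (fun n => dist y (s n) ^ 2) atTop)) := by
  obtain ⟨K, hK⟩ := exists_forall_dist_le hs y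
  have hm : Monotone fun r : ℝ => ENNReal.ofReal (√r) := fun a b hab =>
    ENNReal.ofReal_le_ofReal (Real.sqrt_le_sqrt hab)
  have h := hm.map_limsup_of_continuousAt (F := atTop) (fun n => dist y (s n) ^ 2)
    (ENNReal.continuous_ofReal.comp Real.continuous_sqrt).continuousAt
    (isBoundedUnder_of ⟨K ^ 2, fun n => pow_le_pow_left₀ dist_nonneg (hK n) 2⟩)
    (isBoundedUnder_of ⟨0, fun n => sq_nonneg (dist y (s n))⟩ :
      IsBoundedUnder (· ≥ ·) atTop _).isCoboundedUnder_le
  rw [h]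
  congr 1
  ext n
  simp [Real.sqrt_sq dist_nonneg, edist_dist]

lemma mem_asymptoticCenter_iff [CAT0Space X] {s : ℕ → X}
    (hs : Bornology.IsBounded (Set.range s)) {z : X} :
    z ∈ asymptoticCenter s ↔ ∀ y, limsup (fun n => dist z (s n) ^ 2) atTop ≤
      limsup (fun n => dist y (s n) ^ 2) atTop := by
  refine forall_congr' fun y => ?_
  rw [limsup_edist_eq hs, limsup_edist_eq hs, ENNReal.ofReal_le_ofReal_iff (Real.sqrt_nonneg _),
    Real.sqrt_le_sqrt_iff ((sqDistLike_dist_sq hs).limsup_nonneg y)]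

/-- In a Hadamard space the asymptotic center of a bounded sequence is a single point. -/
lemma exists_asymptoticCenter_eq [CAT0Space X] [CompleteSpace X] {s : ℕ → X}
    (hs : Bornology.IsBounded (Set.range s)) : ∃ p, asymptoticCenter s = {p} := by
  have : Nonempty X := ⟨s 0⟩
  obtain ⟨p, hp⟩ := (sqDistLike_dist_sq hs).exists_isMin
  refine ⟨p, Set.eq_singleton_iff_unique_mem.2 ⟨(mem_asymptoticCenter_iff hs).2 hp, fun z hz => ?_⟩⟩
  exact (sqDistLike_dist_sq hs).eq_of_isMin hp ((mem_asymptoticCenter_iff hs).1 hz)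

lemma limsup_edist_le_of_tendsto_dist {s t : ℕ → X}
    (hst : Tendsto (fun n => dist (s n) (t n)) atTop (𝓝 0)) (y : X) :
    limsup (fun n => edist y (s n)) atTop ≤ limsup (fun n => edist y (t n)) atTop := by
  have h0 : Tendsto (fun n => edist (t n) (s n)) atTop (𝓝 0) := by
    have := (ENNReal.continuous_ofReal.tendsto 0).comp hst
    simpa [Function.comp_def, ← edist_dist, edist_comm] using this
  rw [← ENNReal.limsup_add_of_right_tendsto_zero h0 fun n => edist y (t n)]
  exact limsup_le_limsup (Eventually.of_forall fun n => edist_triangle _ _ _)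

lemma asymptoticCenter_congr {s t : ℕ → X}
    (hst : Tendsto (fun n => dist (s n) (t n)) atTop (𝓝 0)) :
    asymptoticCenter s = asymptoticCenter t := by
  have h : ∀ y, limsup (fun n => edist y (s n)) atTop = limsup (fun n => edist y (t n)) atTop :=
    fun y => le_antisymm (limsup_edist_le_of_tendsto_dist hst y)
      (limsup_edist_le_of_tendsto_dist (by simpa only [dist_comm] using hst) y)
  simp only [asymptoticCenter, h]

/-- If the asymptotic centers of all subsequences of `s` lie in a set `C`, and the distances from
`s` to each point of `C` converge, then those centers coincide and `s` is `Δ`-convergent: the upper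
limit of the distances to a point of `C` does not change on passing to a subsequence. -/
lemma exists_deltaConverges [CAT0Space X] [CompleteSpace X] {s : ℕ → X} {C : Set X}
    (hs : Bornology.IsBounded (Set.range s))
    (hC : ∀ y ∈ C, ∃ l, Tendsto (fun n => dist y (s n)) atTop (𝓝 l))
    (hsub : ∀ φ : ℕ → ℕ, StrictMono φ → asymptoticCenter (s ∘ φ) ⊆ C) :
    ∃ p ∈ C, DeltaConverges s p := by
  obtain ⟨p, hp⟩ := exists_asymptoticCenter_eq hs
  have hpC : p ∈ C := hsub id strictMono_id (by rw [Function.comp_id, hp]; rfl)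
  refine ⟨p, hpC, fun φ hφ => ?_⟩
  obtain ⟨q, hq⟩ := exists_asymptoticCenter_eq (hs.subset (Set.range_comp_subset_range φ s))
  have hqC : q ∈ C := hsub φ hφ (by rw [hq]; rfl)
  have hlim : ∀ y ∈ C, limsup (fun n => edist y (s n)) atTop =
      limsup (fun n => edist y ((s ∘ φ) n)) atTop := by
    intro y hy
    obtain ⟨l, hl⟩ := hC y hy
    have h : Tendsto (fun n => edist y (s n)) atTop (𝓝 (ENNReal.ofReal l)) := by
      simpa [Function.comp_def, ← edist_dist] using (ENNReal.continuous_ofReal.tendsto l).comp hl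
    rw [h.limsup_eq]
    exact (h.comp hφ.tendsto_atTop).limsup_eq.symm
  have hqs : q ∈ asymptoticCenter s := by
    intro y
    have h1 : p ∈ asymptoticCenter s := by rw [hp]; rfl
    have h2 : q ∈ asymptoticCenter (s ∘ φ) := by rw [hq]; rfl
    calc limsup (fun n => edist q (s n)) atTop
        = limsup (fun n => edist q ((s ∘ φ) n)) atTop := hlim q hqC
      _ ≤ limsup (fun n => edist p ((s ∘ φ) n)) atTop := h2 p
      _ = limsup (fun n => edist p (s n)) atTop := (hlim p hpC).symm
      _ ≤ limsup (fun n => edist y (s n)) atTop := h1 y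
  rw [hp] at hqs
  rw [hq, Set.mem_singleton_iff.1 hqs]

end AsymptoticCenter

/-! ### The proximal iteration -/

section Proximal

variable {X : Type*} [MetricSpace X] [CAT0Space X] {A : (x : X) → Set (TangentSp x)}
  {α lam : ℕ → ℝ} {x Jx : ℕ → X}

lemma dist_iterate_sq_le (hα : ∀ n, α n ∈ Set.Ico (0 : ℝ) 1)
    (hx : ∀ n, x (n + 1) = comb (1 - α n) (x n) (Jx n)) (n : ℕ) (u : X) :
    dist (x (n + 1)) u ^ 2 ≤ α n * dist (x n) u ^ 2 + (1 - α n) * dist (Jx n) u ^ 2 := by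
  obtain ⟨h0, h1⟩ := hα n
  have h := dist_comb_sq_le (t := 1 - α n) ⟨by linarith, by linarith⟩ (x n) (Jx n) u
  rw [← hx] at h
  have : 0 ≤ (1 - α n) * (1 - (1 - α n)) * dist (x n) (Jx n) ^ 2 :=
    mul_nonneg (mul_nonneg (by linarith) (by linarith)) (sq_nonneg _)
  linarith

lemma fejer_ineq (hmono : IsMonotoneField A) (hα : ∀ n, α n ∈ Set.Ico (0 : ℝ) 1)
    (hlam : ∀ n, 0 < lam n) (hJx : ∀ n, Jx n ∈ resolvent A (lam n) (x n))
    (hx : ∀ n, x (n + 1) = comb (1 - α n) (x n) (Jx n)) {u : X} (hu : u ∈ zer A) (n : ℕ) :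
    dist (x (n + 1)) u ^ 2 + (1 - α n) * dist (Jx n) (x n) ^ 2 ≤ dist (x n) u ^ 2 := by
  have h1 := dist_iterate_sq_le hα hx n u
  have h2 := mul_le_mul_of_nonneg_left (hmono.resolvent_zer_ineq (hlam n) (hJx n) hu)
    (by linarith [(hα n).2] : 0 ≤ 1 - α n)
  linarith

lemma antitone_dist_sq_iterate (hmono : IsMonotoneField A) (hα : ∀ n, α n ∈ Set.Ico (0 : ℝ) 1)
    (hlam : ∀ n, 0 < lam n) (hJx : ∀ n, Jx n ∈ resolvent A (lam n) (x n))
    (hx : ∀ n, x (n + 1) = comb (1 - α n) (x n) (Jx n)) {u : X} (hu : u ∈ zer A) :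
    Antitone fun n => dist (x n) u ^ 2 := by
  refine antitone_nat_of_succ_le fun n => ?_
  have h1 := fejer_ineq hmono hα hlam hJx hx hu n
  have h2 : 0 ≤ (1 - α n) * dist (Jx n) (x n) ^ 2 :=
    mul_nonneg (by linarith [(hα n).2]) (sq_nonneg _)
  linarith

lemma dist_iterate_le (hmono : IsMonotoneField A) (hα : ∀ n, α n ∈ Set.Ico (0 : ℝ) 1)
    (hlam : ∀ n, 0 < lam n) (hJx : ∀ n, Jx n ∈ resolvent A (lam n) (x n))
    (hx : ∀ n, x (n + 1) = comb (1 - α n) (x n) (Jx n)) {u : X} (hu : u ∈ zer A) (n : ℕ) :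
    dist (x n) u ≤ dist (x 0) u ∧ dist (Jx n) u ≤ dist (x 0) u := by
  have h1 : dist (x n) u ≤ dist (x 0) u := le_of_sq_le_sq
    (antitone_dist_sq_iterate hmono hα hlam hJx hx hu (Nat.zero_le n)) dist_nonneg
  refine ⟨h1, le_trans (le_of_sq_le_sq ?_ dist_nonneg) h1⟩
  linarith [hmono.resolvent_zer_ineq (hlam n) (hJx n) hu, sq_nonneg (dist (Jx n) (x n))]

/-- If the resolvents along the iteration are bounded, the minimizer `y` of the upper limit of the
weighted averages of squared distances to them is a zero of the field: telescoping the resolvent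
inequality shows that `J_1 y` is a better minimizer by `dist (J_1 y) y ^ 2`. -/
lemma zer_nonempty_of_isBounded [CompleteSpace X] (hmono : IsMonotoneField A)
    (hsurj : SurjectivityCondition A) (hα : ∀ n, α n ∈ Set.Ico (0 : ℝ) 1)
    (hlam : ∀ n, 0 < lam n)
    (hsum : Tendsto (fun N => ∑ n ∈ Finset.range N, (1 - α n) * lam n) atTop atTop)
    (hJx : ∀ n, Jx n ∈ resolvent A (lam n) (x n))
    (hx : ∀ n, x (n + 1) = comb (1 - α n) (x n) (Jx n))
    (hbdd : Bornology.IsBounded (Set.range Jx)) : (zer A).Nonempty := by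
  have hw : ∀ n, 0 ≤ (1 - α n) * lam n := fun n =>
    mul_nonneg (by linarith [(hα n).2]) (hlam n).le
  have hf := sqDistLike_avgSqDist hw hsum hbdd
  have : Nonempty X := ⟨x 0⟩
  obtain ⟨y, hy⟩ := hf.exists_isMin
  obtain ⟨w, hwy⟩ := hsurj 1 one_pos y
  have hstep : ∀ n, (1 - α n) * lam n * (dist w y ^ 2 + dist w (Jx n) ^ 2 - dist y (Jx n) ^ 2) ≤
      dist (x n) w ^ 2 - dist (x (n + 1)) w ^ 2 := by
    intro n
    have h1 := hmono.resolvent_ineq (hlam n) one_pos (hJx n) hwy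
    have h2 := dist_iterate_sq_le hα hx n w
    have h3 : lam n * (dist w y ^ 2 + dist w (Jx n) ^ 2 - dist y (Jx n) ^ 2) ≤
        dist (x n) w ^ 2 - dist (Jx n) w ^ 2 := by
      rw [dist_comm w (Jx n)]
      linarith [sq_nonneg (dist (Jx n) (x n))]
    have h4 := mul_le_mul_of_nonneg_left h3 (by linarith [(hα n).2] : 0 ≤ 1 - α n)
    linarith
  have hN : ∀ N, ∑ n ∈ Finset.range N,
      (1 - α n) * lam n * (dist w y ^ 2 + dist w (Jx n) ^ 2 - dist y (Jx n) ^ 2) ≤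
      dist (x 0) w ^ 2 := by
    intro N
    refine (Finset.sum_le_sum fun n _ => hstep n).trans ?_
    rw [Finset.sum_range_sub' (fun n => dist (x n) w ^ 2)]
    linarith [sq_nonneg (dist (x N) w)]
  have hle := hf.limsup_le (a := 1) (c := - dist w y ^ 2) zero_le_one
    (tendsto_const_nhds.div_atTop hsum : Tendsto (fun N => dist (x 0) w ^ 2 /
      ∑ n ∈ Finset.range N, (1 - α n) * lam n) atTop (𝓝 0)) w y (by
    filter_upwards [hsum.eventually_gt_atTop 0] with N hpos
    rw [avgSqDist, avgSqDist, div_le_iff₀ hpos, add_mul, add_mul, one_mul,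
      div_mul_cancel₀ _ hpos.ne', div_mul_cancel₀ _ hpos.ne', Finset.mul_sum]
    have h := hN N
    simp only [mul_sub, mul_add, Finset.sum_sub_distrib, Finset.sum_add_distrib] at h
    have e : ∑ n ∈ Finset.range N, - dist w y ^ 2 * ((1 - α n) * lam n) =
        - ∑ n ∈ Finset.range N, (1 - α n) * lam n * dist w y ^ 2 := by
      rw [← Finset.sum_neg_distrib]
      exact Finset.sum_congr rfl fun n _ => by ring
    linarith)
  have h0 : dist w y ^ 2 ≤ 0 := by linarith [hy w]
  have hwy' : w = y := dist_eq_zero.1 ((pow_eq_zero_iff two_ne_zero).1 (h0.antisymm (sq_nonneg _)))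
  subst hwy'
  exact ⟨w, self_mem_resolvent_iff.1 hwy⟩

lemma tendsto_dist_resolvent (hmono : IsMonotoneField A) (hα : ∀ n, α n ∈ Set.Ico (0 : ℝ) 1)
    (hlam : ∀ n, 0 < lam n) (hJx : ∀ n, Jx n ∈ resolvent A (lam n) (x n))
    (hx : ∀ n, x (n + 1) = comb (1 - α n) (x n) (Jx n)) {u : X} (hu : u ∈ zer A)
    (hsup : (⨆ n, α n) < 1) : Tendsto (fun n => dist (Jx n) (x n)) atTop (𝓝 0) := by
  obtain ⟨l, hl⟩ : ∃ l, Tendsto (fun n => dist (x n) u ^ 2) atTop (𝓝 l) :=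
    ⟨_, tendsto_atTop_ciInf (antitone_dist_sq_iterate hmono hα hlam hJx hx hu)
      ⟨0, by rintro _ ⟨n, rfl⟩; exact sq_nonneg _⟩⟩
  set c := 1 - ⨆ n, α n with hc
  have hc0 : 0 < c := by linarith
  have hαc : ∀ n, c ≤ 1 - α n := fun n => by
    have := le_ciSup (f := α) ⟨1, by rintro _ ⟨k, rfl⟩; exact (hα k).2.le⟩ n
    linarith
  have hdiff : Tendsto (fun n => √((dist (x n) u ^ 2 - dist (x (n + 1)) u ^ 2) / c)) atTop
      (𝓝 0) := by
    have := ((hl.sub (hl.comp (tendsto_add_atTop_nat 1))).div_const c).sqrt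
    simpa using this
  refine squeeze_zero (fun n => dist_nonneg) (fun n => Real.le_sqrt_of_sq_le ?_) hdiff
  rw [le_div_iff₀ hc0]
  have h1 := fejer_ineq hmono hα hlam hJx hx hu n
  have h2 := mul_le_mul_of_nonneg_right (hαc n) (sq_nonneg (dist (Jx n) (x n)))
  linarith

/-- A demiclosedness principle: if resolvents with parameters bounded away from zero move the
terms of a bounded sequence by vanishing amounts, then its asymptotic center consists of zeros. -/
lemma asymptoticCenter_subset_zer (hmono : IsMonotoneField A) (hsurj : SurjectivityCondition A)
    {c : ℝ} (hc : 0 < c) (hlam : ∀ n, c ≤ lam n) (hJx : ∀ n, Jx n ∈ resolvent A (lam n) (x n))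
    (hb : Bornology.IsBounded (Set.range Jx)) (hbx : Bornology.IsBounded (Set.range x))
    (ht : Tendsto (fun n => dist (Jx n) (x n)) atTop (𝓝 0)) :
    asymptoticCenter x ⊆ zer A := by
  intro y hy
  rw [asymptoticCenter_congr (by simpa only [dist_comm] using ht),
    mem_asymptoticCenter_iff hb] at hy
  obtain ⟨w, hwy⟩ := hsurj 1 one_pos y
  obtain ⟨K, hK⟩ := exists_forall_dist_le hb w
  obtain ⟨K', hK'⟩ := exists_forall_dist_le hbx w
  have hle := (sqDistLike_dist_sq hb).limsup_le (a := 1) (c := - dist w y ^ 2)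
    (e := fun n => dist (Jx n) (x n) * (K + K') / c) zero_le_one
    (by simpa using (ht.mul_const (K + K')).div_const c) w y (Eventually.of_forall fun n => by
    have h1 := hmono.resolvent_ineq (hc.trans_le (hlam n)) one_pos (hJx n) hwy
    rw [dist_comm (Jx n) w, dist_comm (x n) w] at h1
    have h2 : dist w (x n) ^ 2 - dist w (Jx n) ^ 2 ≤ dist (Jx n) (x n) * (K + K') := by
      have h3 := dist_triangle w (Jx n) (x n)
      have h4 : (dist w (x n) - dist w (Jx n)) * (dist w (x n) + dist w (Jx n)) ≤
          dist (Jx n) (x n) * (K + K') :=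
        mul_le_mul (by linarith) (by linarith [hK n, hK' n]) (by positivity) dist_nonneg
      linarith
    have hE : 0 ≤ dist (Jx n) (x n) * (K + K') := mul_nonneg dist_nonneg
      (by linarith [hK n, hK' n, dist_nonneg (x := w) (y := x n),
        dist_nonneg (x := w) (y := Jx n)])
    have h5 : lam n * (dist w y ^ 2 + dist w (Jx n) ^ 2 - dist y (Jx n) ^ 2) ≤
        dist (Jx n) (x n) * (K + K') := by linarith [sq_nonneg (dist (Jx n) (x n))]
    have h6 : dist w y ^ 2 + dist w (Jx n) ^ 2 - dist y (Jx n) ^ 2 ≤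
        dist (Jx n) (x n) * (K + K') / c := by
      rw [le_div_iff₀ hc]
      rcases le_total (dist w y ^ 2 + dist w (Jx n) ^ 2 - dist y (Jx n) ^ 2) 0 with h | h
      · exact (mul_nonpos_of_nonpos_of_nonneg h hc.le).trans hE
      · have := mul_le_mul_of_nonneg_right (hlam n) h
        linarith
    linarith)
  have h0 : dist w y ^ 2 ≤ 0 := by linarith [hy w]
  have hwy' : w = y := dist_eq_zero.1 ((pow_eq_zero_iff two_ne_zero).1 (h0.antisymm (sq_nonneg _)))
  subst hwy'
  exact self_mem_resolvent_iff.1 hwy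

end Proximal

end HadamardProx

theorem theorem6p1 {X : Type*} [MetricSpace X] [CompleteSpace X] [HadamardProx.CAT0Space X]
    (A : (x : X) → Set (HadamardProx.TangentSp x))
    (hmono : HadamardProx.IsMonotoneField A)
    (hsurj : HadamardProx.SurjectivityCondition A)
    (α : ℕ → ℝ) (hα : ∀ n, α n ∈ Set.Ico (0 : ℝ) 1)
    (lam : ℕ → ℝ) (hlam : ∀ n, 0 < lam n)
    (hsum : Tendsto (fun N => ∑ n ∈ Finset.range N, (1 - α n) * lam n) atTop atTop)
    (x Jx : ℕ → X) (hJx : ∀ n, Jx n ∈ HadamardProx.resolvent A (lam n) (x n))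
    (hx : ∀ n, x (n + 1) = HadamardProx.comb (1 - α n) (x n) (Jx n)) :
    (Bornology.IsBounded (Set.range Jx) ↔ (HadamardProx.zer A).Nonempty) ∧
    ((HadamardProx.zer A).Nonempty → (⨆ n, α n) < 1 → 0 < (⨅ n, lam n) →
      ∃ p ∈ HadamardProx.zer A,
        HadamardProx.DeltaConverges x p ∧ HadamardProx.DeltaConverges Jx p) := by
  have hbd : ∀ u ∈ HadamardProx.zer A,
      Bornology.IsBounded (Set.range x) ∧ Bornology.IsBounded (Set.range Jx) := by
    intro u hu
    have h := HadamardProx.dist_iterate_le hmono hα hlam hJx hx hu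
    constructor <;> refine (Metric.isBounded_closedBall (x := u) (r := dist (x 0) u)).subset ?_
    · rintro _ ⟨n, rfl⟩; exact (h n).1
    · rintro _ ⟨n, rfl⟩; exact (h n).2
  refine ⟨⟨HadamardProx.zer_nonempty_of_isBounded hmono hsurj hα hlam hsum hJx hx,
    fun ⟨u, hu⟩ => (hbd u hu).2⟩, ?_⟩
  rintro ⟨u, hu⟩ hsup hinf
  obtain ⟨hbx, hbJ⟩ := hbd u hu
  have ht := HadamardProx.tendsto_dist_resolvent hmono hα hlam hJx hx hu hsup
  have hlam' : ∀ n, ⨅ k, lam k ≤ lam n := fun n =>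
    ciInf_le ⟨0, by rintro _ ⟨k, rfl⟩; exact (hlam k).le⟩ n
  obtain ⟨p, hp, hpx⟩ := HadamardProx.exists_deltaConverges (C := HadamardProx.zer A) hbx
    (fun y hy => by
      have hl := (tendsto_atTop_ciInf
        (HadamardProx.antitone_dist_sq_iterate hmono hα hlam hJx hx hy)
        ⟨0, by rintro _ ⟨n, rfl⟩; exact sq_nonneg _⟩).sqrt
      exact ⟨_, by simpa only [Real.sqrt_sq dist_nonneg, dist_comm y] using hl⟩)
    (fun φ hφ => HadamardProx.asymptoticCenter_subset_zer hmono hsurj hinf (fun n => hlam' (φ n))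
      (fun n => hJx (φ n)) (hbJ.subset (Set.range_comp_subset_range φ Jx))
      (hbx.subset (Set.range_comp_subset_range φ x)) (ht.comp hφ.tendsto_atTop))
  refine ⟨p, hp, hpx, fun φ hφ => ?_⟩
  rw [HadamardProx.asymptoticCenter_congr (s := Jx ∘ φ) (t := x ∘ φ) (ht.comp hφ.tendsto_atTop)]
  exact hpx φ hφ
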